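/- **Definitions.** An *initial value problem* in dimension $n\in\mathbb N$ is a triple $(\mathbf f,t_0,\mathbf y_0)$ with $\mathbf f:\mathbb R\times\mathbb R^n\to\mathbb R^n$ smooth ($C^\infty$), $t_0\in\mathbb R$ and $\mathbf y_0\in\mathbb R^n$; a *solution* is a smooth function $\mathbf y:\mathbb R\to\mathbb R^n$ with $\mathbf y'(t)=\mathbf f(t,\mathbf y(t))$ for all $t\in\mathbb R$ and $\mathbf y(t_0)=\mathbf y_0$. Let $A=(a_{ij})\in\mathbb R^{s\times s}$ be strictly lower triangular and let $\mathbf b\in\mathbb R^s$. The explicit *Runge–Kutta method* $(A,\mathbf b)$, applied to $(\mathbf f,t_0,\mathbf y_0)$ with step size $h\in\mathbb R$, produces $$\mathbf k_i:=h\,\mathbf f\Big(t_0+c_ih,\ \mathbf y_0+\sum_{j=1}^{i-1}a_{ij}\mathbf k_j\Big)\quad(i=1,\dots,s),\qquad \mathbf y_1:=\mathbf y_0+\sum_{i=1}^s b_i\mathbf k_i,\qquad\text{where } c_i:=\sum_{j=1}^{i-1}a_{ij}.$$ It has *order* $p\in\mathbb N$ if for every $n$ and every initial value problem $(\mathbf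 f,t_0,\mathbf y_0)$ in dimension $n$ with solution $\mathbf y$, $$\|\mathbf y_1-\mathbf y(t_0+h)\|=O(h^{p+1})\quad\text{as }h\to0.$$ A *rooted tree* $\tau$ is a finite tree with a distinguished vertex, the root; $|\tau|$ is its number of vertices. Write $\tau=[\tau_1,\dots,\tau_m]$ if $\tau_1,\dots,\tau_m$ are the rooted trees obtained by deleting the root of $\tau$, each rooted at its vertex that was adjacent to the root of $\tau$ ($m=0$ for the one-vertex tree). Define recursively $\Phi_A(\tau)\in\mathbb R^s$ and $\tau!\in\mathbb N$ by $$\Phi_A([\tau_1,\dots,\tau_m]):=(A\Phi_A(\tau_1))\odot\cdots\odot(A\Phi_A(\tau_m)),\qquad [\tau_1,\dots,\tau_m]!:=\Big(1+\sum_{i=1}^m|\tau_i|\Big)\prod_{i=1}^m\tau_i!,$$ where $\odot$ is the elementwise product. For $m=0$ these are the all-ones vector and $1$, respectively. **Theorem (Runge–Kutta Order Conditions).** Let $s,p\in\mathbb N$, let $A\in\mathbb R^{s\times s}$ be strictly lower triangular and let $\mathbf b\in\mathbb R^s$. The Runge–Kutta method $(A,\mathbf b)$ has order $p$ if and only if $$\mathbf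 b\cdot\Phi_A(\tau)=\frac1{\tau!}\qquad\text{for all rooted trees }\tau\text{ with }|\tau|\le p.$$ -/

import Mathlib

open scoped ContDiff

namespace RungeKutta

/-! ### Initial value problems -/

/-- An initial value problem in dimension `n`: a smooth right-hand side
`f : ℝ × ℝⁿ → ℝⁿ`, an initial time and an initial value. -/
structure InitialValueProblem (n : ℕ) where
  /-- the right-hand side -/
  f : ℝ × EuclideanSpace ℝ (Fin n) → EuclideanSpace ℝ (Fin n)
  /-- the right-hand side is smooth -/
  smooth : ContDiff ℝ ∞ f
  /-- the initial time -/
  t₀ : ℝ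
  /-- the initial value -/
  y₀ : EuclideanSpace ℝ (Fin n)

/-- A smooth function `y : ℝ → ℝⁿ` with `y'(t) = f(t, y(t))` for all `t` and `y(t₀) = y₀`. -/
structure InitialValueProblem.IsSolution {n : ℕ} (P : InitialValueProblem n)
    (y : ℝ → EuclideanSpace ℝ (Fin n)) : Prop where
  smooth : ContDiff ℝ ∞ y
  hasDerivAt : ∀ t : ℝ, HasDerivAt y (P.f (t, y t)) t
  initial : y P.t₀ = P.y₀

/-! ### Explicit Runge–Kutta methods -/

/-- The matrix `A` is strictly lower triangular. -/
def IsStrictlyLowerTriangular {s : ℕ} (A : Matrix (Fin s) (Fin s) ℝ) : Prop :=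
  ∀ i j : Fin s, i ≤ j → A i j = 0

/-- The abscissae `c_i = ∑_{j < i} a_{ij}`. -/
def abscissa {s : ℕ} (A : Matrix (Fin s) (Fin s) ℝ) (i : Fin s) : ℝ :=
  ∑ j ∈ Finset.Iio i, A i j

/-- The stages `k_i = h f(t₀ + c_i h, y₀ + ∑_{j < i} a_{ij} k_j)`. -/
noncomputable def stage {s n : ℕ} (A : Matrix (Fin s) (Fin s) ℝ) (P : InitialValueProblem n)
    (h : ℝ) (i : Fin s) : EuclideanSpace ℝ (Fin n) :=
  h • P.f (P.t₀ + abscissa A i * h,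
    P.y₀ + ∑ j : {j : Fin s // j < i}, A i j.1 • stage A P h j.1)
termination_by i
decreasing_by exact j.2

/-- The result `y₁ = y₀ + ∑ i, b_i k_i` of one step of size `h` of the method `(A, b)`. -/
noncomputable def step {s n : ℕ} (A : Matrix (Fin s) (Fin s) ℝ) (b : Fin s → ℝ)
    (P : InitialValueProblem n) (h : ℝ) : EuclideanSpace ℝ (Fin n) :=
  P.y₀ + ∑ i, b i • stage A P h i

/-- The method `(A, b)` has order `p`: for every initial value problem, in any dimension, with
exact solution `y`, one has `‖y₁ - y(t₀ + h)‖ = O(h ^ (p + 1))` as `h → 0`. -/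
def HasOrder {s : ℕ} (A : Matrix (Fin s) (Fin s) ℝ) (b : Fin s → ℝ) (p : ℕ) : Prop :=
  ∀ (n : ℕ) (P : InitialValueProblem n) (y : ℝ → EuclideanSpace ℝ (Fin n)),
    P.IsSolution y →
      (fun h : ℝ => ‖step A b P h - y (P.t₀ + h)‖) =O[nhds 0] (fun h : ℝ => h ^ (p + 1))

/-! ### Rooted trees

A rooted tree is Mathlib's `RootedTree`, a tree given by its ancestor order (`v ≤ w` if `v` lies on
the path from the root `⊥` to `w`); the trees used here have finitely many vertices. The edges
directed away from the root are the pairs `v ⋖ w`. A vertex `v` determines the rooted subtree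
`Set.Ici v` consisting of `v` and its descendants, and the legs of this subtree are the subtrees of
the children of `v`. A recursion over the legs of a tree is therefore a recursion over the children
of a vertex, with the whole tree sitting at the vertex `⊥`. -/

section Trees

variable {τ : RootedTree.{0}} [Fintype τ]

open Classical in
/-- The children of a vertex. -/
noncomputable def children (v : τ) : Finset τ :=
  Finset.univ.filter fun w => v ⋖ w

theorem mem_children {v w : τ} : w ∈ children v ↔ v ⋖ w := by
  simp [children]

theorem ncard_Ioi_lt {v w : τ} (hvw : v < w) : (Set.Ioi w).ncard < (Set.Ioi v).ncard :=
  Set.ncard_lt_ncard (Set.Ioi_ssubset_Ioi hvw) (Set.toFinite _)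

/-- The number of vertices of the subtree rooted at `v`. -/
noncomputable def subtreeOrder (v : τ) : ℕ := (Set.Ici v).ncard

/-- The Butcher weight of the subtree rooted at `v`: if this subtree is `[τ₁, …, τₘ]`, it is the
elementwise product of the vectors `A Φ_A(τ₁), …, A Φ_A(τₘ)` (the vector of ones if `m = 0`). -/
noncomputable def butcherWeightAt {s : ℕ} (A : Matrix (Fin s) (Fin s) ℝ) (v : τ) : Fin s → ℝ :=
  ∏ w : {w : τ // w ∈ children v}, A.mulVec (butcherWeightAt A w.1)
termination_by (Set.Ioi v).ncard
decreasing_by exact ncard_Ioi_lt (mem_children.1 w.2).lt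

/-- The factorial of the subtree rooted at `v`: if this subtree is `[τ₁, …, τₘ]`, it is
`(1 + ∑ |τᵢ|) ∏ τᵢ!` (which is `1` if `m = 0`). -/
noncomputable def treeFactorialAt (v : τ) : ℕ :=
  (1 + ∑ w ∈ children v, subtreeOrder w) *
    ∏ w : {w : τ // w ∈ children v}, treeFactorialAt w.1
termination_by (Set.Ioi v).ncard
decreasing_by exact ncard_Ioi_lt (mem_children.1 w.2).lt

end Trees

/-- The Butcher weight `Φ_A(τ)`. -/
noncomputable def butcherWeight {s : ℕ} (A : Matrix (Fin s) (Fin s) ℝ) (τ : RootedTree.{0})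
    [Fintype τ] : Fin s → ℝ :=
  butcherWeightAt A (⊥ : τ)

/-- The factorial (density) `τ!`. -/
noncomputable def treeFactorial (τ : RootedTree.{0}) [Fintype τ] : ℕ :=
  treeFactorialAt (⊥ : τ)

end RungeKutta

/-!
The exact solution and the stages of the method satisfy equations of the same kind. After the time
has been added as an unknown (which is harmless because `c_i = ∑ a_{ij}`), the problem is
`x' = g(x)`, `x(t₀) = x₀`, and the arguments `Z` at which `g` is evaluated satisfy
`Z_i = x₀ + h ∑ a_{ij} g(Z_j)` for the stages and `Z' = g(Z)` for the exact solution.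

**The conditions suffice.** By Faà di Bruno's formula the `k`-th derivative of `g(Z)` at `h = 0` is
a sum of values of the derivatives of `g` at `x₀`, which are common to the stages and the exact
solution, at derivatives of `Z` whose orders add up to `k`. Passing from `g(Z)` back to `Z` applies
`A` to the stages and integrates the exact solution. By induction, the family of these `k`-th
derivatives, indexed by the stages and the exact solution, lies in the span of the families with
entries `Φ_A(τ)_i` for the stages and `|τ| / τ!` for the exact solution, where `|τ| = k + 1`
(`iteratedDeriv_mem_slopeSpan`): the products of the weights of `τ₁, …, τₘ` which arise are the
weights of the grafted tree `[τ₁, …, τₘ]` (`slopeWeight_graft`). Only membership in the span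
matters, so the coefficients, and with them the symmetries of the trees, never have to be found.
The order conditions make the derivatives of order at most `p` of the error vanish on this span,
and Taylor's theorem gives the order.

**The conditions are necessary.** For a tree `τ` the problem `y_v' = ∏ y_w`, with the product over
the children `w` of `v`, and `y(0) = 0`, has the solution `y_v(t) = t ^ |τ_v| / τ_v!`, while the
method yields `h ^ |τ| (b ⬝ Φ_A(τ))` at the root (`stage_treeProblem`). The error at the root is
thus exactly `(b ⬝ Φ_A(τ) - 1 / τ!) h ^ |τ|`, and this is `O(h ^ (p + 1))` with `|τ| ≤ p` only if the
coefficient is zero.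
-/

namespace RungeKutta

/-! ### Recursion over the children of a vertex -/

section Vertices

variable {τ : RootedTree.{0}} [Fintype τ]

theorem butcherWeightAt_eq {s : ℕ} (A : Matrix (Fin s) (Fin s) ℝ) (v : τ) :
    butcherWeightAt A v = ∏ w ∈ children v, A.mulVec (butcherWeightAt A w) := by
  rw [butcherWeightAt]
  exact Finset.prod_coe_sort (children v) fun w => A.mulVec (butcherWeightAt A w)

theorem treeFactorialAt_eq (v : τ) :
    treeFactorialAt v =
      (1 + ∑ w ∈ children v, subtreeOrder w) * ∏ w ∈ children v, treeFactorialAt w := by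
  rw [treeFactorialAt, ← Finset.prod_coe_sort (children v)]

/-- The descendants of `v` are the disjoint union of the subtrees at the children of `v`. -/
theorem subtreeOrder_eq (v : τ) : subtreeOrder v = 1 + ∑ w ∈ children v, subtreeOrder w := by
  classical
  have hdisj : ((children v : Finset τ) : Set τ).PairwiseDisjoint (fun w => Set.Ici w) := by
    intro w hw w' hw' hne
    rw [Function.onFun, Set.disjoint_left]
    intro u hu hu'
    have hw := mem_children.1 hw
    have hw' := mem_children.1 hw'
    rcases le_total_of_directed (Set.mem_Ici.1 hu) (Set.mem_Ici.1 hu') with h | h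
    · exact hne (h.eq_of_not_lt (hw.2 hw'.lt)).symm
    · exact hne (h.eq_of_not_lt (hw'.2 hw.lt))
  have hIci : Set.Ici v = insert v (⋃ w ∈ children v, Set.Ici w) := by
    ext u
    simp only [Set.mem_Ici, Set.mem_insert_iff, Set.mem_iUnion, mem_children, exists_prop]
    constructor
    · intro h
      rcases h.eq_or_lt with h | h
      · exact Or.inl h.symm
      · exact Or.inr (exists_covBy_le_of_lt h)
    · rintro (rfl | ⟨w, hw, hwu⟩)
      · exact le_rfl
      · exact hw.le.trans hwu
  have hv : v ∉ ⋃ w ∈ children v, Set.Ici w := by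
    simp only [Set.mem_iUnion, mem_children, exists_prop, not_exists, not_and, Set.mem_Ici]
    exact fun w hw => hw.lt.not_ge
  rw [subtreeOrder, hIci, Set.ncard_insert_of_notMem hv (Set.toFinite _), add_comm]
  congr 1
  have := Finset.card_biUnion (s := children v) (t := fun w => (Set.Ici w).toFinset)
    (fun w hw w' hw' hne => by
      have := hdisj hw hw' hne
      simpa [Function.onFun] using this)
  simp only [subtreeOrder, Set.ncard_eq_toFinset_card']
  rw [← this]
  congr 1
  ext u
  simp

theorem subtreeOrder_bot : subtreeOrder (⊥ : τ) = Fintype.card τ := by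
  simp [subtreeOrder, Set.ncard_univ]

theorem treeFactorialAt_eq_subtreeOrder_mul (v : τ) :
    treeFactorialAt v = subtreeOrder v * ∏ w ∈ children v, treeFactorialAt w := by
  rw [treeFactorialAt_eq, subtreeOrder_eq]

theorem subtreeOrder_pos (v : τ) : 0 < subtreeOrder v := by
  rw [subtreeOrder_eq]; omega

end Vertices

section Embedding

variable {σ τ : RootedTree.{0}}

theorem subtreeOrder_map (e : σ ↪o τ) (he : IsUpperSet (Set.range e)) (v : σ) :
    subtreeOrder (e v) = subtreeOrder v := by
  rw [subtreeOrder, subtreeOrder, ← Set.ncard_image_of_injective _ e.injective]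
  congr 1
  ext w
  constructor
  · intro h
    obtain ⟨u, rfl⟩ := he h ⟨v, rfl⟩
    exact ⟨u, e.le_iff_le.1 h, rfl⟩
  · rintro ⟨u, hu, rfl⟩
    exact e.le_iff_le.2 hu

variable [Fintype σ] [Fintype τ]

/-- The vertices of an upper set keep their children, so that the subtree at a vertex and its
invariants do not change under an embedding of `σ` as an upper set. -/
theorem children_map (e : σ ↪o τ) (he : IsUpperSet (Set.range e)) (v : σ) :
    children (e v) = (children v).map e.toEmbedding := by
  ext w
  simp only [mem_children, Finset.mem_map, RelEmbedding.coe_toEmbedding]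
  constructor
  · intro h
    obtain ⟨u, rfl⟩ := he h.le ⟨v, rfl⟩
    exact ⟨u, CovBy.of_image e h, rfl⟩
  · rintro ⟨u, hu, rfl⟩
    exact hu.image e he.ordConnected

theorem butcherWeightAt_map {s : ℕ} (A : Matrix (Fin s) (Fin s) ℝ) (e : σ ↪o τ)
    (he : IsUpperSet (Set.range e)) (v : σ) :
    butcherWeightAt A (e v) = butcherWeightAt A v := by
  induction v using WellFoundedGT.induction with
  | ind v ih =>
    rw [butcherWeightAt_eq, butcherWeightAt_eq, children_map e he, Finset.prod_map]
    refine Finset.prod_congr rfl fun w hw => ?_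
    rw [RelEmbedding.coe_toEmbedding, ih w (mem_children.1 hw).lt]

theorem treeFactorialAt_map (e : σ ↪o τ) (he : IsUpperSet (Set.range e)) (v : σ) :
    treeFactorialAt (e v) = treeFactorialAt v := by
  induction v using WellFoundedGT.induction with
  | ind v ih =>
    rw [treeFactorialAt_eq_subtreeOrder_mul, treeFactorialAt_eq_subtreeOrder_mul,
      children_map e he, Finset.prod_map, subtreeOrder_map e he]
    congr 1
    refine Finset.prod_congr rfl fun w hw => ?_
    rw [RelEmbedding.coe_toEmbedding, ih w (mem_children.1 hw).lt]

end Embedding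

/-! ### Grafting trees onto a common root -/

section Graft

variable {ι : Type} (τ : ι → RootedTree.{0})

open Classical in
/-- The greatest lower bound in the disjoint union of the `τ i` with a new least element:
computed in `τ i` for two vertices of the same `τ i`, and the new root otherwise. -/
noncomputable def graftInf : WithBot (Σ i, τ i) → WithBot (Σ i, τ i) → WithBot (Σ i, τ i)
  | some ⟨i, v⟩, some ⟨j, w⟩ => if h : j = i then some ⟨i, v ⊓ (h ▸ w)⟩ else ⊥
  | _, _ => ⊥

open Classical in
/-- The parent of a vertex in the disjoint union of the `τ i` with a new least element: the
parents of the roots of the `τ i` are the new root. -/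
noncomputable def graftPred : WithBot (Σ i, τ i) → WithBot (Σ i, τ i)
  | some ⟨i, v⟩ => if v = ⊥ then ⊥ else some ⟨i, Order.pred v⟩
  | _ => ⊥

variable {τ}

theorem graftInf_self {i : ι} (v w : τ i) :
    graftInf τ (some ⟨i, v⟩) (some ⟨i, w⟩) = some ⟨i, v ⊓ w⟩ :=
  dif_pos rfl

theorem graftInf_of_ne {i j : ι} (v : τ i) (w : τ j) (h : j ≠ i) :
    graftInf τ (some ⟨i, v⟩) (some ⟨j, w⟩) = ⊥ :=
  dif_neg h

theorem graftPred_root (i : ι) : graftPred τ (some ⟨i, ⊥⟩) = ⊥ :=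
  if_pos rfl

theorem graftPred_of_ne {i : ι} {v : τ i} (h : v ≠ ⊥) :
    graftPred τ (some ⟨i, v⟩) = some ⟨i, Order.pred v⟩ :=
  if_neg h

theorem graft_coe_le_coe {i : ι} {v : τ i} {x : Σ i, τ i} :
    ((x : Σ i, τ i) : WithBot (Σ i, τ i)) ≤ ((⟨i, v⟩ : Σ i, τ i) : WithBot (Σ i, τ i)) ↔
      ∃ u : τ i, x = ⟨i, u⟩ ∧ u ≤ v := by
  rw [WithBot.coe_le_coe]
  obtain ⟨j, w⟩ := x
  constructor
  · rintro ⟨_, _, _, h⟩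
    exact ⟨_, rfl, h⟩
  · rintro ⟨u, hu, h⟩
    rw [hu]
    exact Sigma.mk_le_mk_iff.2 h

variable (τ) [Fintype ι] [∀ i, Fintype (τ i)]

/-- The tree `[τ₁, …, τₘ]`: the disjoint union of the trees `τ i`, with a new root below them. -/
@[reducible] noncomputable def graft : RootedTree.{0} :=
  letI : SemilatticeInf (WithBot (Σ i, τ i)) :=
    { (inferInstance : PartialOrder (WithBot (Σ i, τ i))) with
      inf := graftInf τ
      inf_le_left := by
        rintro (_ | ⟨i, v⟩) (_ | ⟨j, w⟩)
        · exact bot_le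
        · exact bot_le
        · exact bot_le
        · by_cases h : j = i
          · subst h
            rw [graftInf_self]
            exact graft_coe_le_coe.2 ⟨_, rfl, inf_le_left⟩
          · rw [graftInf_of_ne v w h]
            exact bot_le
      inf_le_right := by
        rintro (_ | ⟨i, v⟩) (_ | ⟨j, w⟩)
        · exact bot_le
        · exact bot_le
        · exact bot_le
        · by_cases h : j = i
          · subst h
            rw [graftInf_self]
            exact graft_coe_le_coe.2 ⟨_, rfl, inf_le_right⟩
          · rw [graftInf_of_ne v w h]
            exact bot_le
      le_inf := by
        rintro (_ | x) (_ | ⟨i, v⟩) (_ | ⟨j, w⟩) h₁ h₂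
        iterate 4 exact bot_le
        · exact h₁
        · exact h₁
        · exact h₂
        · obtain ⟨u, rfl, hu⟩ := graft_coe_le_coe.1 h₁
          obtain ⟨u', h', hu'⟩ := graft_coe_le_coe.1 h₂
          cases h'
          rw [graftInf_self]
          exact graft_coe_le_coe.2 ⟨_, rfl, le_inf hu hu'⟩ }
  letI : PredOrder (WithBot (Σ i, τ i)) :=
    { pred := graftPred τ
      pred_le := by
        rintro (_ | ⟨i, v⟩)
        · exact bot_le
        · by_cases h : v = ⊥
          · rw [h, graftPred_root]
            exact bot_le
          · rw [graftPred_of_ne h]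
            exact graft_coe_le_coe.2 ⟨_, rfl, Order.pred_le v⟩
      min_of_le_pred := by
        rintro (_ | ⟨i, v⟩) h
        · exact isMin_bot
        · by_cases hv : v = ⊥
          · rw [hv, graftPred_root] at h
            exact absurd (le_bot_iff.1 h) (WithBot.coe_ne_bot)
          · rw [graftPred_of_ne hv] at h
            obtain ⟨u, hu, hu'⟩ := graft_coe_le_coe.1 h
            cases hu
            exact absurd (isMin_iff_eq_bot.1 (Order.min_of_le_pred hu')) hv
      le_pred_of_lt := by
        rintro (_ | x) (_ | ⟨i, v⟩) h
        · exact bot_le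
        · exact bot_le
        · exact absurd h not_lt_bot
        · obtain ⟨u, rfl, hu⟩ := graft_coe_le_coe.1 h.le
          have huv : u < v := hu.lt_of_ne (by rintro rfl; exact lt_irrefl _ h)
          have hv : v ≠ ⊥ := (bot_le.trans_lt huv).ne'
          rw [graftPred_of_ne hv]
          exact graft_coe_le_coe.2 ⟨_, rfl, Order.le_pred_of_lt huv⟩ }
  { α := WithBot (Σ i, τ i) }

noncomputable instance : Fintype (graft τ) :=
  inferInstanceAs (Fintype (Option (Σ i, τ i)))

/-- The inclusion of `τ i` into the tree `[τ₁, …, τₘ]`. -/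
noncomputable def graftEmb (i : ι) : τ i ↪o graft τ where
  toFun v := ((⟨i, v⟩ : Σ i, τ i) : WithBot (Σ i, τ i))
  inj' v w h := by
    have := WithBot.coe_injective h
    cases this
    rfl
  map_rel_iff' {v w} := by
    refine Iff.trans graft_coe_le_coe ⟨?_, fun h => ⟨v, rfl, h⟩⟩
    rintro ⟨u, hu, h⟩
    cases hu
    exact h

theorem isUpperSet_range_graftEmb (i : ι) : IsUpperSet (Set.range (graftEmb τ i)) := by
  rintro _ (_ | ⟨j, w⟩) h ⟨v, rfl⟩
  · exact absurd (le_bot_iff.1 h) WithBot.coe_ne_bot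
  · obtain ⟨u, hu, -⟩ := graft_coe_le_coe.1 h
    cases hu
    exact ⟨w, rfl⟩

theorem mem_children_graft_bot {w : graft τ} :
    w ∈ children (⊥ : graft τ) ↔ ∃ i, graftEmb τ i ⊥ = w := by
  rw [mem_children]
  constructor
  · intro h
    rcases w with _ | ⟨i, v⟩
    · exact absurd h.lt (lt_irrefl _)
    · refine ⟨i, ?_⟩
      have hle : graftEmb τ i ⊥ ≤ graftEmb τ i v := (graftEmb τ i).monotone bot_le
      exact hle.eq_of_not_lt (h.2 (WithBot.bot_lt_coe _))
  · rintro ⟨i, rfl⟩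
    refine ⟨WithBot.bot_lt_coe _, ?_⟩
    rintro (_ | x) h₁ h₂
    · exact lt_irrefl _ h₁
    · obtain ⟨u, rfl, hu⟩ := graft_coe_le_coe.1 h₂.le
      cases le_bot_iff.1 hu
      exact lt_irrefl _ h₂

@[to_additive]
theorem prod_children_graft_bot {M : Type*} [CommMonoid M] (F : graft τ → M) :
    ∏ w ∈ children (⊥ : graft τ), F w = ∏ i, F (graftEmb τ i ⊥) := by
  symm
  refine Finset.prod_bij (fun i _ => graftEmb τ i ⊥)
    (fun i _ => (mem_children_graft_bot τ).2 ⟨i, rfl⟩) ?_ ?_ fun _ _ => rfl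
  · intro i _ j _ h
    exact congrArg Sigma.fst (WithBot.coe_injective h)
  · intro w hw
    obtain ⟨i, hi⟩ := (mem_children_graft_bot τ).1 hw
    exact ⟨i, Finset.mem_univ _, hi⟩

theorem card_graft : Fintype.card (graft τ) = 1 + ∑ i, Fintype.card (τ i) := by
  rw [← subtreeOrder_bot, subtreeOrder_eq, sum_children_graft_bot]
  simp_rw [subtreeOrder_map _ (isUpperSet_range_graftEmb τ _), subtreeOrder_bot]

theorem butcherWeight_graft {s : ℕ} (A : Matrix (Fin s) (Fin s) ℝ) :
    butcherWeight A (graft τ) = ∏ i, A.mulVec (butcherWeight A (τ i)) := by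
  rw [butcherWeight, butcherWeightAt_eq, prod_children_graft_bot]
  simp_rw [butcherWeightAt_map A _ (isUpperSet_range_graftEmb τ _)]
  rfl

theorem treeFactorial_graft :
    treeFactorial (graft τ) = Fintype.card (graft τ) * ∏ i, treeFactorial (τ i) := by
  rw [treeFactorial, treeFactorialAt_eq_subtreeOrder_mul, prod_children_graft_bot,
    subtreeOrder_bot]
  simp_rw [treeFactorialAt_map _ (isUpperSet_range_graftEmb τ _)]
  rfl

end Graft

/-! ### The initial value problem of a tree -/

/-- The sum over `j < i` in the definition of the stages may run over all `j`. -/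
theorem stage_eq {s n : ℕ} {A : Matrix (Fin s) (Fin s) ℝ} (hA : IsStrictlyLowerTriangular A)
    (P : InitialValueProblem n) (h : ℝ) (i : Fin s) :
    stage A P h i = h • P.f (P.t₀ + abscissa A i * h, P.y₀ + ∑ j, A i j • stage A P h j) := by
  have hsum : ∑ j : {j : Fin s // j < i}, A i j.1 • stage A P h j.1 =
      ∑ j, A i j • stage A P h j := by
    rw [← Finset.sum_subset (Finset.subset_univ (Finset.Iio i)) fun j _ hj => by
      rw [hA i j (not_lt.1 fun h => hj (Finset.mem_Iio.2 h)), zero_smul]]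
    exact (Finset.sum_subtype (Finset.Iio i) (fun j => Finset.mem_Iio)
      fun j => A i j • stage A P h j).symm
  rw [stage, hsum]

theorem abscissa_eq {s : ℕ} {A : Matrix (Fin s) (Fin s) ℝ} (hA : IsStrictlyLowerTriangular A)
    (i : Fin s) : abscissa A i = ∑ j, A i j :=
  Finset.sum_subset (Finset.subset_univ _) fun j _ hj =>
    hA i j (not_lt.1 fun h => hj (Finset.mem_Iio.2 h))

section Necessity

variable (τ : RootedTree.{0}) [Fintype τ]

/-- The initial value problem whose unknowns are indexed by the vertices of `τ`, given by
`y_v' = ∏ y_w` (the product over the children `w` of `v`) and `y(0) = 0`. The vertices are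
numbered by `Fintype.equivFin`. -/
noncomputable def treeProblem : InitialValueProblem (Fintype.card τ) where
  f x := WithLp.toLp 2 fun a =>
    ∏ w ∈ children ((Fintype.equivFin τ).symm a), x.2 (Fintype.equivFin τ w)
  smooth := by
    rw [contDiff_euclidean]
    intro a
    exact contDiff_prod fun w _ => by fun_prop
  t₀ := 0
  y₀ := 0

/-- The exact solution of `treeProblem`: `y_v(t) = t ^ |τ_v| / τ_v!`, where `τ_v` is the subtree
rooted at `v`. -/
noncomputable def treeSolution (t : ℝ) : EuclideanSpace ℝ (Fin (Fintype.card τ)) :=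
  WithLp.toLp 2 fun a => t ^ subtreeOrder ((Fintype.equivFin τ).symm a) /
    treeFactorialAt ((Fintype.equivFin τ).symm a)

theorem isSolution_treeSolution : (treeProblem τ).IsSolution (treeSolution τ) where
  smooth := by
    rw [contDiff_euclidean]
    intro a
    simp only [treeSolution]
    fun_prop
  hasDerivAt t := by
    refine (PiLp.continuousLinearEquiv 2 ℝ
      fun _ : Fin (Fintype.card τ) => ℝ).symm.hasFDerivAt.comp_hasDerivAt t
        (hasDerivAt_pi.2 fun a => ?_)
    set v := (Fintype.equivFin τ).symm a
    have h0 : (subtreeOrder v : ℝ) ≠ 0 := by exact_mod_cast (subtreeOrder_pos v).ne'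
    refine ((hasDerivAt_pow (subtreeOrder v) t).div_const (treeFactorialAt v : ℝ)).congr_deriv ?_
    simp only [treeSolution, Equiv.symm_apply_apply]
    rw [treeFactorialAt_eq_subtreeOrder_mul, Nat.cast_mul, mul_div_mul_left _ _ h0,
      Finset.prod_div_distrib, Finset.prod_pow_eq_pow_sum, Nat.cast_prod, subtreeOrder_eq,
      Nat.add_sub_cancel_left]
  initial := by
    ext a
    simp [treeSolution, treeProblem, (subtreeOrder_pos _).ne']

variable {τ}

/-- The stages of the method for the problem of a tree are monomials in the step size, with the
Butcher weights as coefficients. -/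
theorem stage_treeProblem {s : ℕ} {A : Matrix (Fin s) (Fin s) ℝ}
    (hA : IsStrictlyLowerTriangular A) (h : ℝ) (v : τ) (i : Fin s) :
    stage A (treeProblem τ) h i (Fintype.equivFin τ v) =
      h ^ subtreeOrder v * butcherWeightAt A v i := by
  induction v using WellFoundedGT.induction generalizing i with
  | ind v ih =>
    rw [stage_eq hA, subtreeOrder_eq, pow_add, pow_one, butcherWeightAt_eq, Finset.prod_apply,
      mul_assoc, ← Finset.prod_pow_eq_pow_sum, ← Finset.prod_mul_distrib]
    simp only [treeProblem, PiLp.smul_apply, smul_eq_mul, Equiv.symm_apply_apply, zero_add]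
    congr 1
    refine Finset.prod_congr rfl fun w hw => ?_
    have ih' := ih w (mem_children.1 hw).lt
    simp only [treeProblem] at ih'
    simp only [WithLp.ofLp_sum, Finset.sum_apply, PiLp.smul_apply, smul_eq_mul, ih',
      Matrix.mulVec, dotProduct, Finset.mul_sum]
    exact Finset.sum_congr rfl fun j _ => by ring

/-- A method of order `p` satisfies the order condition of each tree with at most `p` vertices:
compare the root components for the problem of that tree. -/
theorem HasOrder.dotProduct_butcherWeight {s p : ℕ} {A : Matrix (Fin s) (Fin s) ℝ}
    {b : Fin s → ℝ} (hA : IsStrictlyLowerTriangular A) (hAb : HasOrder A b p)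
    (hτ : Fintype.card τ ≤ p) :
    b ⬝ᵥ butcherWeight A τ = 1 / (treeFactorial τ : ℝ) := by
  have hO := hAb _ _ _ (isSolution_treeSolution τ)
  set r := Fintype.equivFin τ ⊥ with hr
  set C := b ⬝ᵥ butcherWeight A τ - 1 / (treeFactorial τ : ℝ) with hC
  have hcomp (h : ℝ) : (step A b (treeProblem τ) h - treeSolution τ ((treeProblem τ).t₀ + h)) r =
      C * h ^ Fintype.card τ := by
    have hst : ∀ i, stage A (treeProblem τ) h i r = h ^ Fintype.card τ * butcherWeight A τ i := by
      intro i
      rw [hr, stage_treeProblem hA, subtreeOrder_bot, butcherWeight]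
    rw [PiLp.sub_apply, step, PiLp.add_apply]
    simp only [WithLp.ofLp_sum, Finset.sum_apply, PiLp.smul_apply, smul_eq_mul, hst]
    simp only [treeProblem, treeSolution, hr, Equiv.symm_apply_apply, subtreeOrder_bot, hC,
      dotProduct, treeFactorial, sub_mul, Finset.sum_mul, PiLp.zero_apply, zero_add]
    congr 1
    · exact Finset.sum_congr rfl fun j _ => by ring
    · ring
  have hO' : (fun h : ℝ => C * h ^ Fintype.card τ) =O[nhds 0] fun h : ℝ => h ^ (p + 1) := by
    refine Asymptotics.IsBigO.trans (Asymptotics.IsBigO.of_bound 1 ?_) hO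
    refine Filter.Eventually.of_forall fun h => ?_
    rw [← hcomp, one_mul, norm_norm]
    exact PiLp.norm_apply_le _ _
  -- `C * h ^ |τ| = O(h ^ (p + 1))` with `|τ| ≤ p` gives `C = o(1)`, that is `C = 0`
  have hlt : Fintype.card τ < p + 1 := Nat.lt_succ_of_le hτ
  have ho : (fun h : ℝ => C * h ^ Fintype.card τ) =o[nhdsWithin 0 {0}ᶜ]
      fun h : ℝ => h ^ Fintype.card τ :=
    (hO'.trans_isLittleO (Asymptotics.isLittleO_pow_pow hlt)).mono nhdsWithin_le_nhds
  have hC0 : (fun _ : ℝ => C) =o[nhdsWithin 0 {0}ᶜ] fun _ : ℝ => (1 : ℝ) := by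
    have := ho.mul_isBigO (Asymptotics.isBigO_refl
      (fun h : ℝ => (h ^ Fintype.card τ)⁻¹) (nhdsWithin 0 {0}ᶜ))
    refine this.congr' ?_ ?_ <;>
    · filter_upwards [self_mem_nhdsWithin] with h hh
      have hh' : h ^ Fintype.card τ ≠ 0 := pow_ne_zero _ hh
      field_simp
  exact sub_eq_zero.1 (tendsto_nhds_unique tendsto_const_nhds
    ((Asymptotics.isLittleO_one_iff ℝ).1 hC0))

end Necessity

/-! ### Taylor coefficients as combinations of trees -/

section Weights

variable {s : ℕ} (A : Matrix (Fin s) (Fin s) ℝ)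

/-- The coefficients of the tree `τ` in the slopes: `Φ_A(τ)` for the stages of the method (the
indices `some i`) and `|τ| / τ!` for the exact solution (the index `none`). -/
noncomputable def slopeWeight (τ : RootedTree.{0}) [Fintype τ] : Option (Fin s) → ℝ
  | some i => butcherWeight A τ i
  | none => Fintype.card τ / treeFactorial τ

/-- The coefficients of the tree `τ` in the arguments at which the slopes are taken: `A Φ_A(τ)`
for the stages of the method and `1 / τ!` for the exact solution. -/
noncomputable def argumentWeight (τ : RootedTree.{0}) [Fintype τ] : Option (Fin s) → ℝ
  | some i => A.mulVec (butcherWeight A τ) i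
  | none => 1 / treeFactorial τ

/-- The weight recursion is the same for the stages and for the exact solution, where it says that
`|τ| / τ! = ∏ 1 / τᵢ!` for `τ = [τ₁, …, τₘ]`. -/
theorem slopeWeight_graft {ι : Type} [Fintype ι] (τ : ι → RootedTree.{0}) [∀ i, Fintype (τ i)]
    (o : Option (Fin s)) : slopeWeight A (graft τ) o = ∏ i, argumentWeight A (τ i) o := by
  cases o with
  | some i => simp [slopeWeight, argumentWeight, butcherWeight_graft, Finset.prod_apply]
  | none =>
    have h : (Fintype.card (graft τ) : ℝ) ≠ 0 := by
      rw [card_graft]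
      positivity
    simp only [slopeWeight, argumentWeight, treeFactorial_graft, Nat.cast_mul, Nat.cast_prod]
    rw [Finset.prod_div_distrib, Finset.prod_const_one, div_mul_eq_div_div, div_self h]

variable (E : Type*) [NormedAddCommGroup E] [NormedSpace ℝ E]

/-- The families of vectors (one for each stage of the method and one for the exact solution)
spanned by the slope weights of the trees with `k` vertices. -/
def slopeSpan (k : ℕ) : Submodule ℝ (Option (Fin s) → E) :=
  Submodule.span ℝ {x | ∃ (τ : RootedTree.{0}) (_ : Fintype τ) (e : E),
    Fintype.card τ = k ∧ x = fun o => slopeWeight A τ o • e}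

/-- The families of vectors spanned by the argument weights of the trees with `k` vertices. -/
def argumentSpan (k : ℕ) : Submodule ℝ (Option (Fin s) → E) :=
  Submodule.span ℝ {x | ∃ (τ : RootedTree.{0}) (_ : Fintype τ) (e : E),
    Fintype.card τ = k ∧ x = fun o => argumentWeight A τ o • e}

variable {A E}

/-- A multilinear map sends families in the argument spans to the slope span, because the product
of the argument weights of `τ₁, …, τₘ` is the slope weight of `[τ₁, …, τₘ]`. -/
theorem multilinear_mem_slopeSpan {m : ℕ} (M : MultilinearMap ℝ (fun _ : Fin m => E) E)
    (k : Fin m → ℕ) (x : Fin m → Option (Fin s) → E) (hx : ∀ j, x j ∈ argumentSpan A E (k j)) :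
    (fun o => M fun j => x j o) ∈ slopeSpan A E (1 + ∑ j, k j) := by
  simp only [argumentSpan, Submodule.mem_span_set'] at hx
  choose N c y hy using hx
  choose τ hF e hτ hye using fun j (l : Fin (N j)) => (y j l).2
  have hM : (fun o => M fun j => x j o) = ∑ r : (∀ j, Fin (N j)), (∏ j, c j (r j)) •
      fun o => slopeWeight A (graft fun j => τ j (r j)) o • M fun j => e j (r j) := by
    ext o
    have hxo : (fun j => x j o) =
        fun j => ∑ l, (c j l * argumentWeight A (τ j l) o) • e j l := by
      ext j
      rw [← hy j, Finset.sum_apply]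
      refine Finset.sum_congr rfl fun l _ => ?_
      rw [Pi.smul_apply, hye, mul_smul]
    rw [hxo, M.map_sum, Finset.sum_apply]
    refine Finset.sum_congr rfl fun r _ => ?_
    rw [M.map_smul_univ, Finset.prod_mul_distrib, mul_smul, Pi.smul_apply, slopeWeight_graft]
  rw [hM]
  refine Submodule.sum_mem _ fun r _ => Submodule.smul_mem _ _ (Submodule.subset_span ?_)
  refine ⟨graft fun j => τ j (r j), inferInstance, _, ?_, rfl⟩
  rw [card_graft]
  simp_rw [hτ]

/-- Passing from slopes to arguments: the stages are combined by `A`, the exact solution is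
integrated. -/
theorem mem_argumentSpan_of_mem_slopeSpan {k : ℕ} {x y : Option (Fin s) → E}
    (hx : x ∈ slopeSpan A E (k + 1))
    (hsome : ∀ i, y (some i) = (k + 1 : ℝ) • ∑ j, A i j • x (some j))
    (hnone : y none = x none) : y ∈ argumentSpan A E (k + 1) := by
  have hy : y = fun o => match o with
      | some i => (k + 1 : ℝ) • ∑ j, A i j • x (some j)
      | none => x none := by
    ext o
    cases o with
    | some i => exact hsome i
    | none => exact hnone
  rw [hy]
  clear hy hsome hnone y
  induction hx using Submodule.span_induction with
  | mem x hx =>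
    obtain ⟨τ, hF, e, hτ, rfl⟩ := hx
    have : (fun o : Option (Fin s) => match o with
        | some i => (k + 1 : ℝ) • ∑ j, A i j • slopeWeight A τ (some j) • e
        | none => slopeWeight A τ none • e) =
        (k + 1 : ℝ) • fun o => argumentWeight A τ o • e := by
      ext o
      cases o with
      | some i =>
        simp only [slopeWeight, argumentWeight, Pi.smul_apply, Matrix.mulVec, dotProduct,
          Finset.sum_smul, mul_smul]
      | none =>
        simp only [slopeWeight, argumentWeight, Pi.smul_apply, hτ, smul_smul]
        push_cast
        rw [mul_one_div]
    rw [this]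
    exact Submodule.smul_mem _ _ (Submodule.subset_span ⟨τ, hF, e, hτ, rfl⟩)
  | zero =>
    convert Submodule.zero_mem _ using 1
    ext o
    cases o <;> simp
  | add x₁ x₂ _ _ h₁ h₂ =>
    convert Submodule.add_mem _ h₁ h₂ using 1
    ext o
    cases o <;> simp [Finset.sum_add_distrib]
  | smul c x _ h =>
    convert Submodule.smul_mem _ c h using 1
    ext o
    cases o with
    | some i =>
      simp only [Pi.smul_apply, Finset.smul_sum]
      refine Finset.sum_congr rfl fun j _ => ?_
      rw [smul_comm (A i j) c, smul_comm (k + 1 : ℝ) c]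
    | none => rfl

/-- Under the order condition for the trees with `k` vertices, the slopes of degree `k - 1` are
such that the update `h ∑ b_i G_i` and the integrated exact slope agree in degree `k`. -/
theorem smul_sum_eq_of_mem_slopeSpan {k : ℕ} {b : Fin s → ℝ}
    (hb : ∀ (τ : RootedTree.{0}) [Fintype τ], Fintype.card τ = k →
      b ⬝ᵥ butcherWeight A τ = 1 / (treeFactorial τ : ℝ))
    {x : Option (Fin s) → E} (hx : x ∈ slopeSpan A E k) :
    (k : ℝ) • ∑ i, b i • x (some i) = x none := by
  induction hx using Submodule.span_induction with
  | mem x hx =>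
    obtain ⟨τ, hF, e, hτ, rfl⟩ := hx
    have h := hb τ hτ
    rw [dotProduct] at h
    simp only [slopeWeight, smul_smul, ← Finset.sum_smul, h, hτ, mul_one_div]
  | zero => simp
  | add x₁ x₂ _ _ h₁ h₂ => simp [Finset.sum_add_distrib, ← h₁, ← h₂]
  | smul c x _ h =>
    simp only [Pi.smul_apply, ← h, Finset.smul_sum]
    refine Finset.sum_congr rfl fun j _ => ?_
    rw [smul_comm (b j) c, smul_comm (k : ℝ) c]

end Weights

section Calculus

variable {E : Type*} [NormedAddCommGroup E] [NormedSpace ℝ E]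

theorem iteratedDeriv_succ_id_smul_zero {F : ℝ → E} (hF : ContDiff ℝ ∞ F) (k : ℕ) :
    iteratedDeriv (k + 1) (fun h : ℝ => h • F h) 0 = (k + 1 : ℝ) • iteratedDeriv k F 0 := by
  have key : ∀ k : ℕ, iteratedDeriv (k + 1) (fun h : ℝ => h • F h) =
      fun h => h • iteratedDeriv (k + 1) F h + (k + 1 : ℝ) • iteratedDeriv k F h := by
    have hd (k : ℕ) (h : ℝ) : HasDerivAt (iteratedDeriv k F) (iteratedDeriv (k + 1) F h) h := by
      rw [iteratedDeriv_succ]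
      exact ((hF.differentiable_iteratedDeriv k (by exact_mod_cast ENat.natCast_lt_top k)) h).hasDerivAt
    intro k
    induction k with
    | zero =>
      ext h
      have := (hasDerivAt_id h).smul (hd 0 h)
      refine (congrFun iteratedDeriv_one h).trans (this.deriv.trans ?_)
      simp
    | succ k ih =>
      rw [iteratedDeriv_succ, ih]
      ext h
      have := ((hasDerivAt_id h).smul (hd (k + 1) h)).add ((hd k h).const_smul (k + 1 : ℝ))
      refine this.deriv.trans ?_
      simp only [id, one_smul, Nat.cast_add, Nat.cast_one, add_smul]
      abel
  simp [key]

theorem isBigO_pow_of_iteratedDeriv_eq_zero {D : ℝ → E} (hD : ContDiff ℝ ∞ D) {p : ℕ}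
    (h0 : ∀ k ≤ p, iteratedDeriv k D 0 = 0) :
    D =O[nhds 0] fun h : ℝ => h ^ (p + 1) := by
  have hT := (taylor_isLittleO_univ (x₀ := 0) (n := p + 1)
    (hD.of_le (by exact_mod_cast le_top))).isBigO
  have hpoly : (fun h => taylorWithinEval D (p + 1) Set.univ 0 h) =O[nhds 0]
      fun h : ℝ => (h - 0) ^ (p + 1) := by
    have : (fun h => taylorWithinEval D (p + 1) Set.univ 0 h) = fun h =>
        (((p + 1).factorial : ℝ)⁻¹ * (h - 0) ^ (p + 1)) • iteratedDeriv (p + 1) D 0 := by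
      ext h
      rw [taylor_within_apply, Finset.sum_range_succ, Finset.sum_eq_zero, zero_add,
        iteratedDerivWithin_univ]
      intro k hk
      rw [iteratedDerivWithin_univ, h0 k (by simpa [Nat.lt_succ_iff] using hk), smul_zero]
    rw [this]
    refine Asymptotics.IsBigO.of_bound (‖((p + 1).factorial : ℝ)⁻¹‖ * ‖iteratedDeriv (p + 1) D 0‖)
      (Filter.Eventually.of_forall fun h => ?_)
    rw [norm_smul, norm_mul]
    exact le_of_eq (by ring)
  simpa using hT.add hpoly

end Calculus

/-! ### Order for autonomous problems -/

section Autonomous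

variable {E : Type*} [NormedAddCommGroup E] [NormedSpace ℝ E] {s : ℕ}
  {A : Matrix (Fin s) (Fin s) ℝ} {g : E → E} {x₀ : E} {Z : Option (Fin s) → ℝ → E}

/-- The `k`-th derivatives of the slopes at step size `0` are combinations of the trees with
`k + 1` vertices: by Faà di Bruno's formula they are values of the derivatives of `g` at `x₀`
(the same for all stages and for the exact solution) at derivatives of the arguments of smaller
total order. Here `Z (some i)` is the argument of the `i`-th stage and `Z none` the exact
solution. -/
theorem iteratedDeriv_mem_slopeSpan (hg : ContDiff ℝ ∞ g) (hZ : ∀ o, ContDiff ℝ ∞ (Z o))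
    (hsome : ∀ i h, Z (some i) h = x₀ + h • ∑ j, A i j • g (Z (some j) h))
    (hnone : ∀ h, HasDerivAt (Z none) (g (Z none h)) h) (h0 : Z none 0 = x₀) (k : ℕ) :
    (fun o => iteratedDeriv k (g ∘ Z o) 0) ∈ slopeSpan A E (k + 1) := by
  have hZ0 : ∀ o, Z o 0 = x₀ := by
    rintro (_ | i)
    · exact h0
    · rw [hsome, zero_smul, add_zero]
  induction k using Nat.strong_induction_on with
  | _ k ih =>
    have harg : ∀ l, 0 < l → l ≤ k →
        (fun o => iteratedDeriv l (Z o) 0) ∈ argumentSpan A E l := by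
      intro l hl hlk
      obtain ⟨l, rfl⟩ := Nat.exists_eq_succ_of_ne_zero hl.ne'
      refine mem_argumentSpan_of_mem_slopeSpan (ih l hlk) (fun i => ?_) ?_
      · have hG : ∀ j, ContDiff ℝ ∞ fun h => A i j • g (Z (some j) h) := fun j =>
          (hg.comp (hZ _)).const_smul _
        rw [show Z (some i) = fun h => x₀ + h • ∑ j, A i j • g (Z (some j) h) from
          funext (hsome i), iteratedDeriv_const_add (Nat.succ_pos l),
          iteratedDeriv_succ_id_smul_zero (ContDiff.sum fun j _ => hG j),
          iteratedDeriv_fun_sum fun j _ => ((hG j).of_le (by exact_mod_cast le_top)).contDiffAt]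
        congr 1
        refine Finset.sum_congr rfl fun j _ => ?_
        exact iteratedDeriv_fun_const_smul_field _ _
      · rw [Nat.succ_eq_add_one, iteratedDeriv_succ', funext fun h => (hnone h).deriv]
        rfl
    have hfdb : (fun o => iteratedDeriv k (g ∘ Z o) 0) = ∑ c : OrderedFinpartition k,
        fun o => iteratedFDeriv ℝ c.length g x₀ fun j => iteratedDeriv (c.partSize j) (Z o) 0 := by
      ext o
      rw [iteratedDeriv_vcomp_eq_sum_orderedFinpartition (n := ∞) hg.contDiffAt (hZ o).contDiffAt
        (by exact_mod_cast le_top), Finset.sum_apply, hZ0]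
    rw [hfdb]
    refine Submodule.sum_mem _ fun c _ => ?_
    have hc : ∑ j, c.partSize j = k := by
      simpa using Fintype.card_congr c.equivSigma
    have := multilinear_mem_slopeSpan (A := A) (iteratedFDeriv ℝ c.length g x₀).toMultilinearMap
      c.partSize (fun j o => iteratedDeriv (c.partSize j) (Z o) 0)
      fun j => harg _ (c.partSize_pos j) (c.partSize_le j)
    rwa [hc, add_comm] at this

/-- Under the order conditions for the trees with at most `p` vertices, the error of one step for an
autonomous problem has vanishing derivatives up to order `p`. -/
theorem isBigO_of_order_conditions (hg : ContDiff ℝ ∞ g) (hZ : ∀ o, ContDiff ℝ ∞ (Z o))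
    (hsome : ∀ i h, Z (some i) h = x₀ + h • ∑ j, A i j • g (Z (some j) h))
    (hnone : ∀ h, HasDerivAt (Z none) (g (Z none h)) h) (h0 : Z none 0 = x₀)
    {b : Fin s → ℝ} {p : ℕ}
    (hb : ∀ (τ : RootedTree.{0}) [Fintype τ], Fintype.card τ ≤ p →
      b ⬝ᵥ butcherWeight A τ = 1 / (treeFactorial τ : ℝ)) :
    (fun h => x₀ + h • ∑ i, b i • g (Z (some i) h) - Z none h) =O[nhds 0]
      fun h : ℝ => h ^ (p + 1) := by
  have hG : ∀ i, ContDiff ℝ ∞ fun h => b i • g (Z (some i) h) := fun i =>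
    (hg.comp (hZ _)).const_smul _
  have hS : ContDiff ℝ ∞ fun h => ∑ i, b i • g (Z (some i) h) := ContDiff.sum fun i _ => hG i
  have hU : ContDiff ℝ ∞ fun h : ℝ => x₀ + h • ∑ i, b i • g (Z (some i) h) :=
    contDiff_const.add (contDiff_id.smul hS)
  refine isBigO_pow_of_iteratedDeriv_eq_zero (hU.sub (hZ none)) fun k hk => ?_
  rcases k with _ | k
  · simp [h0]
  · have hsub := iteratedDeriv_sub (n := k + 1) (x := 0)
      (hU.of_le (by exact_mod_cast le_top)).contDiffAt
      ((hZ none).of_le (by exact_mod_cast le_top)).contDiffAt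
    refine hsub.trans (sub_eq_zero.2 ?_)
    have hmem := iteratedDeriv_mem_slopeSpan hg hZ hsome hnone h0 k
    have h := smul_sum_eq_of_mem_slopeSpan (fun τ _ hτ => hb τ (hτ.le.trans hk)) hmem
    rw [iteratedDeriv_const_add (Nat.succ_pos k), iteratedDeriv_succ_id_smul_zero hS,
      iteratedDeriv_fun_sum fun j _ => ((hG j).of_le (by exact_mod_cast le_top)).contDiffAt,
      iteratedDeriv_succ', funext fun h => (hnone h).deriv]
    refine Eq.trans ?_ h
    push_cast
    congr 1
    refine Finset.sum_congr rfl fun j _ => ?_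
    exact iteratedDeriv_fun_const_smul_field _ _

end Autonomous

/-! ### Reduction to autonomous problems -/

section Sufficiency

variable {s n : ℕ} {A : Matrix (Fin s) (Fin s) ℝ}

theorem contDiff_stage (hA : IsStrictlyLowerTriangular A) (P : InitialValueProblem n)
    (i : Fin s) : ContDiff ℝ ∞ fun h => stage A P h i := by
  induction i using WellFoundedLT.induction with
  | ind i ih =>
    simp_rw [stage_eq hA P _ i]
    have hsum : ContDiff ℝ ∞ fun h => ∑ j, A i j • stage A P h j := by
      refine ContDiff.sum fun j _ => ?_
      by_cases hj : j < i
      · exact (ih j hj).const_smul _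
      · simp only [hA i j (not_lt.1 hj), zero_smul]
        exact contDiff_const
    exact contDiff_id.smul (P.smooth.comp
      ((contDiff_const.add (contDiff_const.mul contDiff_id)).prodMk (contDiff_const.add hsum)))

theorem hasOrder_of_order_conditions (hA : IsStrictlyLowerTriangular A) {b : Fin s → ℝ} {p : ℕ}
    (hb : ∀ (τ : RootedTree.{0}) [Fintype τ], Fintype.card τ ≤ p →
      b ⬝ᵥ butcherWeight A τ = 1 / (treeFactorial τ : ℝ)) : HasOrder A b p := by
  intro n P y hy
  -- the autonomous problem with the time as an additional unknown; as `c_i = ∑ a_{ij}`, the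
  -- method treats both problems alike
  set g : ℝ × EuclideanSpace ℝ (Fin n) → ℝ × EuclideanSpace ℝ (Fin n) := fun x => (1, P.f x)
    with hg
  set Z : Option (Fin s) → ℝ → ℝ × EuclideanSpace ℝ (Fin n) := fun o h => match o with
    | some i => (P.t₀ + abscissa A i * h, P.y₀ + ∑ j, A i j • stage A P h j)
    | none => (P.t₀ + h, y (P.t₀ + h)) with hZdef
  have hst : ∀ i h, stage A P h i = h • P.f (Z (some i) h) := fun i h => stage_eq hA P h i
  have hgs : ContDiff ℝ ∞ g := contDiff_const.prodMk P.smooth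
  have hZ : ∀ o, ContDiff ℝ ∞ (Z o) := by
    rintro (_ | i)
    · have ht : ContDiff ℝ ∞ fun h : ℝ => P.t₀ + h := contDiff_const.add contDiff_id
      exact ht.prodMk (hy.smooth.comp ht)
    · exact (contDiff_const.add (contDiff_const.mul contDiff_id)).prodMk
        (contDiff_const.add (ContDiff.sum fun j _ => (contDiff_stage hA P j).const_smul _))
  have hsome : ∀ i h, Z (some i) h = (P.t₀, P.y₀) + h • ∑ j, A i j • g (Z (some j) h) := by
    intro i h
    ext1
    · simp [hZdef, hg, abscissa_eq hA, Prod.fst_sum, mul_comm]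
    · simp only [Prod.snd_add, Prod.smul_snd, Prod.snd_sum, hg, Finset.smul_sum]
      simp only [hZdef, add_right_inj]
      refine Finset.sum_congr rfl fun j _ => ?_
      rw [hst, smul_comm]
  have hnone : ∀ h, HasDerivAt (Z none) (g (Z none h)) h := by
    intro h
    have ht : HasDerivAt (fun h : ℝ => P.t₀ + h) 1 h := (hasDerivAt_id h).const_add _
    have hy' := (hy.hasDerivAt (P.t₀ + h)).scomp h ht
    rw [one_smul] at hy'
    exact ht.prodMk hy'
  have h0 : Z none 0 = (P.t₀, P.y₀) := by simp [hZdef, hy.initial]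
  have hmain := isBigO_of_order_conditions hgs hZ hsome hnone h0 hb
  refine (Asymptotics.IsBigO.trans (Asymptotics.IsBigO.of_bound 1 ?_) hmain).norm_left
  refine Filter.Eventually.of_forall fun h => ?_
  have hsnd : step A b P h - y (P.t₀ + h) =
      ((P.t₀, P.y₀) + h • ∑ i, b i • g (Z (some i) h) - Z none h).2 := by
    simp only [Prod.snd_sub, Prod.snd_add, Prod.smul_snd, Prod.snd_sum, hg, Finset.smul_sum, step]
    congr 2
    refine Finset.sum_congr rfl fun j _ => ?_
    rw [hst, smul_comm]
  rw [hsnd, one_mul]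
  exact norm_snd_le _

end Sufficiency

end RungeKutta

/-- An explicit Runge–Kutta method `(A, b)` has order `p` if and only if `b ⬝ Φ_A(τ) = 1 / τ!` for
every rooted tree `τ` with at most `p` vertices. -/
theorem theorem1p23 {s : ℕ} (A : Matrix (Fin s) (Fin s) ℝ)
    (hA : RungeKutta.IsStrictlyLowerTriangular A) (b : Fin s → ℝ) (p : ℕ) :
    RungeKutta.HasOrder A b p ↔
      ∀ (τ : RootedTree.{0}) [Fintype τ], Fintype.card τ ≤ p →
        b ⬝ᵥ RungeKutta.butcherWeight A τ = 1 / (RungeKutta.treeFactorial τ : ℝ) :=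
  ⟨fun h _ _ hτ => h.dotProduct_butcherWeight hA hτ,
    RungeKutta.hasOrder_of_order_conditions hA⟩
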